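/- Let $r,m\ge 1$ be integers and let all random elements below be defined on one probability space $(\Omega,\mathfrak F,\mathsf P)$. For each $n\ge 1$ let $X_{n,1},X_{n,2},\dots$ be independent (not necessarily identically distributed) random vectors in $\mathbb R^r$; for $n,k\ge1$ let $T_{n,k}=T_{n,k}(X_{n,1},\dots,X_{n,k})$ be a measurable function of $X_{n,1},\dots,X_{n,k}$ with values in $\mathbb R^m$. For each $n\ge1$ let $N_n$ be an integer-valued random variable with $N_n\ge 1$ almost surely, such that $N_n$ and $T_{n,k}$ are independent for all $n,k\ge1$, and put $T_{n,N_n}(\omega)=T_{n,N_n(\omega)}(X_{n,1}(\omega),\dots,X_{n,N_n(\omega)}(\omega))$. Let $\theta_n,a_n,b_n\in\mathbb R^m$ and $\sigma_n>0$ be non-random, with $a_n\to a\in\mathbb R^m$ and $b_n\to b\in\mathbb R^m$, and let $h_{n,k}(t)$, $t\in\mathbb R^m$, be the characteristic function of $$Y_{n,k}=\sigma_n\sqrt k\,(T_{n,k}-\theta_n)-\sqrt{n/k}\;a_n ,$$ that is, of $Y_{n,k}=b_{n,k}^{-1}(T_{n,k}-\theta_n-a_{n,k})$ with $b_{n,k}=(\sigma_n\sqrt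 k)^{-1}$ and $a_{n,k}=(\sigma_n k)^{-1}\sqrt n\,a_n$. Assume that the family $\{n/N_n\}_{n\ge1}$ is tight and that $T_{n,k}$ is asymptotically normal in the following sense: there is a symmetric positive definite $m\times m$ matrix $\Sigma$ such that for every $R\in(0,\infty)$ $$\lim_{n\to\infty}\mathsf E\sup_{\|t\|\le R}\bigl|h_{n,N_n}(t)-\exp\{-\tfrac12 t^{\top}\Sigma t\}\bigr|=0 .$$ Then, for every random vector $Z$ in $\mathbb R^m$, $$\sigma_n\sqrt n\,(T_{n,N_n}-\theta_n)-b_n\Longrightarrow Z\qquad(n\to\infty)$$ (weak convergence) if and only if there is a probability measure $G$ on $\mathbb R$ with $G((-\infty,0))=0$ such that the law $F$ of $Z$ is the normal variance-mean mixture $F=N_{-b+za,\,z\Sigma}\circ G$, i.e. $F(B)=\int_{[0,\infty)}N_{-b+za,\,z\Sigma}(B)\,G(dz)$ for all Borel sets $B\subseteq\mathbb R^m$, and $n/N_n$ converges in distribution to $G$. Here $N_{c,\,V}$ is the normal law with mean $c$ and covariance matrix $V$, so $N_{-b,\,0}$ is the point mass at $-b$. In particular, $\sigma_n\sqrt n\,(T_{n,N_n}-\theta_n)-b_n$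 has some weak limit if and only if $n/N_n$ converges in distribution to some probability measure $G$ with $G((-\infty,0))=0$. -/

import Mathlib

open MeasureTheory ProbabilityTheory Filter Topology

namespace RandomSize

/-- `m`-dimensional Euclidean space. -/
abbrev Vec (m : ℕ) : Type := EuclideanSpace ℝ (Fin m)

/-- The statistic `T_{n,k} = T_{n,k}(X_{n,1}, …, X_{n,k})` as a function on the sample space;
the observation `X_{n,j}` is stored as `X n (j - 1)`. -/
def statistic {Ω : Type*} {r m : ℕ} (T : ∀ _n k : ℕ, (Fin k → Vec r) → Vec m)
    (X : ℕ → ℕ → Ω → Vec r) (n k : ℕ) (ω : Ω) : Vec m :=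
  T n k (fun j : Fin k => X n j ω)

/-- The statistic `T_{n,N_n}` constructed from the sample with random size `N_n`. -/
def randomStatistic {Ω : Type*} {r m : ℕ} (T : ∀ _n k : ℕ, (Fin k → Vec r) → Vec m)
    (X : ℕ → ℕ → Ω → Vec r) (N : ℕ → Ω → ℕ) (n : ℕ) (ω : Ω) : Vec m :=
  statistic T X n (N n ω) ω

/-- The scaling constant `b_{n,k} = (σ_n √k)⁻¹`. -/
noncomputable def scale (σ : ℕ → ℝ) (n k : ℕ) : ℝ := (σ n * √(k : ℝ))⁻¹

/-- The centering vector `a_{n,k} = (σ_n k)⁻¹ √n a_n`. -/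
noncomputable def center {m : ℕ} (σ : ℕ → ℝ) (a : ℕ → Vec m) (n k : ℕ) : Vec m :=
  ((σ n * (k : ℝ))⁻¹ * √(n : ℝ)) • a n

/-- The normalized statistic with non-random sample size,
`Y_{n,k} = b_{n,k}⁻¹ (T_{n,k} - θ_n - a_{n,k}) = σ_n √k (T_{n,k} - θ_n) - √(n/k) a_n`. -/
noncomputable def normalized {Ω : Type*} {r m : ℕ} (T : ∀ _n k : ℕ, (Fin k → Vec r) → Vec m)
    (X : ℕ → ℕ → Ω → Vec r) (θ : ℕ → Vec m) (σ : ℕ → ℝ) (a : ℕ → Vec m)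
    (n k : ℕ) (ω : Ω) : Vec m :=
  (scale σ n k)⁻¹ • (statistic T X n k ω - θ n - center σ a n k)

/-- The normalized statistic with random sample size, `Z_n = σ_n √n (T_{n,N_n} - θ_n) - b_n`. -/
noncomputable def randomNormalized {Ω : Type*} {r m : ℕ}
    (T : ∀ _n k : ℕ, (Fin k → Vec r) → Vec m)
    (X : ℕ → ℕ → Ω → Vec r) (N : ℕ → Ω → ℕ) (θ : ℕ → Vec m) (σ : ℕ → ℝ) (b : ℕ → Vec m)
    (n : ℕ) (ω : Ω) : Vec m :=
  (σ n * √(n : ℝ)) • (randomStatistic T X N n ω - θ n) - b n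

/-- The characteristic function `exp (-tᵀ S t / 2)` of the centered normal law with
covariance matrix `S`. -/
noncomputable def normalCharFun {m : ℕ} (S : Matrix (Fin m) (Fin m) ℝ) (t : Vec m) : ℂ :=
  Complex.exp (((-(1 / 2) * (t.ofLp ⬝ᵥ S.mulVec t.ofLp) : ℝ)) : ℂ)

/-- Asymptotic normality with random sample size: for every `R > 0`,
`E sup_{‖t‖ ≤ R} |h_{n,N_n}(t) - exp (-tᵀ S t / 2)| → 0`, where `h_{n,k}` is the (non-random)
characteristic function of `Y n k`. -/
def AsymptoticallyNormal {Ω : Type*} [MeasurableSpace Ω] {m : ℕ} (P : Measure Ω)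
    (Y : ℕ → ℕ → Ω → Vec m) (N : ℕ → Ω → ℕ) (S : Matrix (Fin m) (Fin m) ℝ) : Prop :=
  ∀ R : ℝ, 0 < R →
    Tendsto (fun n : ℕ => ∫ ω, (⨆ t : Metric.closedBall (0 : Vec m) R,
      ‖charFun (P.map (Y n (N n ω))) (t : Vec m) - normalCharFun S (t : Vec m)‖) ∂P)
      atTop (𝓝 0)

/-- `F` is the normal variance-mean mixture `N_{c + z a, z S} ∘ G`, that is,
`F(B) = ∫ N_{c + z a, z S}(B) G(dz)`, for a mixing law `G` carried by `[0, ∞)`.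
(For `z = 0` the normal law is the point mass at `c`.) -/
def IsNormalMixture {m : ℕ} (c a : Vec m) (S : Matrix (Fin m) (Fin m) ℝ)
    (G : Measure ℝ) (F : Measure (Vec m)) : Prop :=
  ∀ B : Set (Vec m), MeasurableSet B →
    F B = ∫⁻ z in Set.Ici (0 : ℝ), multivariateGaussian (c + z • a) (z • S) B ∂G

end RandomSize

/-!
Write `V_n = n / N_n` and let `e(t) = i⟨t, a₀⟩ - tᵀ S t / 2`. For `N_n = k` the normalized statistic is
`√(n/k) Y_{n,k} + (n/k) a_n - b_n`, so independence of `N_n` and the `T_{n,k}` gives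
(`charFun_map_randomNormalized`) that its characteristic function at `t` is
`E [exp (i (V_n ⟨a_n, t⟩ - ⟨b_n, t⟩)) h_{n,N_n}(√V_n t)]`.
On an event `{V_n ≤ K}`, whose probability is close to `1` uniformly in `n` by tightness, the argument
`√V_n t` stays in a fixed ball, so asymptotic normality allows `h_{n,N_n}` to be replaced by the normal
characteristic function. Hence (`tendsto_charFun_sub_complexMGF`) the characteristic function of the
normalized statistic differs by `o(1)` from `exp (-i⟨b₀, t⟩) E [exp (e(t) V_n)]`.

On the other side, the mixture with mixing law `G` has the characteristic function
`exp (-i⟨b₀, t⟩) ∫ exp (e(t) z) G(dz)` (`charFun_mixtureLaw`), and `z ↦ exp (e(t) z)` is bounded and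
continuous on `[0, ∞)` because `Re e(t) ≤ 0`. So convergence of `V_n` to `G` yields convergence to the
mixture by Lévy's theorem. Conversely, if the normalized statistic converges in law, then the transforms
`E [exp (e(t) V_n)]` converge; by Prokhorov's theorem the laws of `V_n` have limit points, and all limit
points have the same transform along `t ↦ e(t)`. These mixtures are identifiable
(`eq_of_complexMGF_mixExponent_eq`): for `t ≠ 0` the curve `x ↦ e(x t)` accumulates inside the open left
half-plane, where `s ↦ ∫ exp (s z) G(dz)` is holomorphic, so the identity theorem determines this function
on the half-plane and, by passing to the boundary, the characteristic function of `G`. All limit points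
therefore coincide and `V_n` converges (`exists_tendsto_of_tendsto_complexMGF`).
-/

namespace RandomSize

/-! ### The exponent of the mixture transform -/

/-- The exponent `e(t) = i⟨t, a⟩ - tᵀ S t / 2`: for `z ≥ 0`, the function `t ↦ exp (z e(t))` is the
characteristic function of the normal law with mean `z a` and covariance matrix `z S`. -/
noncomputable def mixExponent {m : ℕ} (a : Vec m) (S : Matrix (Fin m) (Fin m) ℝ) (t : Vec m) : ℂ :=
  (inner ℝ t a : ℝ) * Complex.I - ((t.ofLp ⬝ᵥ S.mulVec t.ofLp : ℝ) : ℂ) / 2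

lemma mixExponent_re {m : ℕ} (a : Vec m) (S : Matrix (Fin m) (Fin m) ℝ) (t : Vec m) :
    (mixExponent a S t).re = -(t.ofLp ⬝ᵥ S.mulVec t.ofLp) / 2 := by
  simp only [mixExponent, Complex.sub_re, Complex.re_ofReal_mul, Complex.I_re, mul_zero]
  rw [Complex.div_ofNat_re, Complex.ofReal_re]
  ring

lemma mixExponent_smul {m : ℕ} (a : Vec m) (S : Matrix (Fin m) (Fin m) ℝ) (t : Vec m) (x : ℝ) :
    mixExponent a S (x • t) = (x * inner ℝ t a : ℝ) * Complex.I
      - ((x ^ 2 * (t.ofLp ⬝ᵥ S.mulVec t.ofLp) : ℝ) : ℂ) / 2 := by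
  simp only [mixExponent, inner_smul_left, WithLp.ofLp_smul, Matrix.mulVec_smul, dotProduct_smul,
    smul_dotProduct, smul_eq_mul]
  congr 3
  ring

lemma quadForm_nonneg {m : ℕ} {S : Matrix (Fin m) (Fin m) ℝ} (hS : S.PosSemidef) (t : Vec m) :
    0 ≤ t.ofLp ⬝ᵥ S.mulVec t.ofLp := by
  simpa using hS.dotProduct_mulVec_nonneg t.ofLp

lemma mixExponent_re_nonpos {m : ℕ} (a : Vec m) {S : Matrix (Fin m) (Fin m) ℝ} (hS : S.PosSemidef)
    (t : Vec m) : (mixExponent a S t).re ≤ 0 := by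
  rw [mixExponent_re]
  linarith [quadForm_nonneg hS t]

/-! ### Transforms of laws on the half-line and identifiability -/

lemma ae_nonneg_of_measure_Iio_eq_zero {G : Measure ℝ} (hG : G (Set.Iio 0) = 0) :
    ∀ᵐ z ∂G, 0 ≤ z := by
  rw [ae_iff]
  simpa [Set.Iio] using hG

lemma norm_cexp_mul_le_one {s : ℂ} (hs : s.re ≤ 0) {z : ℝ} (hz : 0 ≤ z) :
    ‖Complex.exp (s * z)‖ ≤ 1 := by
  rw [Complex.norm_exp, Complex.re_mul_ofReal]
  exact Real.exp_le_one_iff.2 (mul_nonpos_of_nonpos_of_nonneg hs hz)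

lemma integrable_cexp_mul {G : Measure ℝ} [IsFiniteMeasure G] (hG : G (Set.Iio 0) = 0)
    {s : ℂ} (hs : s.re ≤ 0) : Integrable (fun z : ℝ => Complex.exp (s * z)) G := by
  refine Integrable.of_bound (by fun_prop) 1 ?_
  filter_upwards [ae_nonneg_of_measure_Iio_eq_zero hG] with z hz using norm_cexp_mul_le_one hs hz

lemma analyticOnNhd_complexMGF_of_nonneg {G : Measure ℝ} [IsFiniteMeasure G]
    (hG : G (Set.Iio 0) = 0) : AnalyticOnNhd ℂ (complexMGF id G) {s | s.re < 0} := by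
  refine analyticOnNhd_complexMGF.mono fun s hs => ?_
  refine mem_interior.2 ⟨Set.Iio 0, fun x hx => ?_, isOpen_Iio, hs⟩
  have h := (integrable_cexp_mul (s := x) hG (by simpa using (le_of_lt hx : x ≤ 0))).norm
  simpa [integrableExpSet, Complex.norm_exp] using h

/-- A finite measure on `[0, ∞)` is determined by its transform on the open left half-plane: the
characteristic function is the boundary value of the transform on the imaginary axis. -/
lemma measure_eq_of_complexMGF_eq {G G' : Measure ℝ} [IsFiniteMeasure G] [IsFiniteMeasure G']
    (hG : G (Set.Iio 0) = 0) (hG' : G' (Set.Iio 0) = 0)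
    (h : ∀ s : ℂ, s.re < 0 → complexMGF id G s = complexMGF id G' s) : G = G' := by
  have key : ∀ (H : Measure ℝ) [IsFiniteMeasure H], H (Set.Iio 0) = 0 → ∀ y : ℝ,
      Tendsto (fun x : ℝ => complexMGF id H (x + y * Complex.I)) (𝓝[<] 0)
        (𝓝 (charFun H y)) := by
    intro H _ hH y
    rw [← complexMGF_id_mul_I]
    refine tendsto_integral_filter_of_dominated_convergence (fun _ => 1) ?_ ?_
      (integrable_const _) ?_
    · exact Eventually.of_forall fun x => by fun_prop
    · filter_upwards [self_mem_nhdsWithin] with x hx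
      filter_upwards [ae_nonneg_of_measure_Iio_eq_zero hH] with z hz
      exact norm_cexp_mul_le_one (by simpa using (le_of_lt hx : x ≤ 0)) hz
    · refine Eventually.of_forall fun z => ?_
      have : Continuous fun x : ℝ => Complex.exp ((x + y * Complex.I) * (id z : ℝ)) := by fun_prop
      simpa using (this.tendsto 0).mono_left nhdsWithin_le_nhds
  refine Measure.ext_of_charFun (funext fun y => ?_)
  refine tendsto_nhds_unique (key G hG y) ((key G' hG' y).congr' ?_)
  filter_upwards [self_mem_nhdsWithin] with x hx
  exact (h _ (by simpa using hx)).symm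

/-- Identifiability of the mixing law: the transform is holomorphic on the open left half-plane, and
the values of `mixExponent a S` along one ray have an accumulation point there. -/
lemma eq_of_complexMGF_mixExponent_eq {m : ℕ} (hm : 1 ≤ m) (a : Vec m)
    {S : Matrix (Fin m) (Fin m) ℝ} (hS : S.PosDef) {G G' : Measure ℝ} [IsFiniteMeasure G]
    [IsFiniteMeasure G'] (hG : G (Set.Iio 0) = 0) (hG' : G' (Set.Iio 0) = 0)
    (h : ∀ t, complexMGF id G (mixExponent a S t) = complexMGF id G' (mixExponent a S t)) :
    G = G' := by
  obtain ⟨t, ht⟩ : ∃ t : Vec m, t ≠ 0 :=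
    ⟨EuclideanSpace.single ⟨0, hm⟩ 1, by simp⟩
  have hq : 0 < t.ofLp ⬝ᵥ S.mulVec t.ofLp := by
    simpa using hS.dotProduct_mulVec_pos (x := t.ofLp) (by simpa using ht)
  have hre : ∀ x : ℝ, (mixExponent a S (x • t)).re = -(x ^ 2 * (t.ofLp ⬝ᵥ S.mulVec t.ofLp)) / 2 := by
    intro x
    rw [mixExponent_re]
    simp only [WithLp.ofLp_smul, Matrix.mulVec_smul, dotProduct_smul, smul_dotProduct, smul_eq_mul]
    ring
  refine measure_eq_of_complexMGF_eq hG hG' ?_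
  refine AnalyticOnNhd.eqOn_of_preconnected_of_frequently_eq (z₀ := mixExponent a S t)
    (analyticOnNhd_complexMGF_of_nonneg hG) (analyticOnNhd_complexMGF_of_nonneg hG')
    (convex_halfSpace_re_lt 0).isPreconnected (by
      have := hre 1
      simp only [one_smul] at this
      change (mixExponent a S t).re < 0
      rw [this]; linarith) ?_
  -- The real part of the exponent is strictly decreasing along the ray, so the values for `x > 1`
  -- differ from the value at `x = 1`.
  have hcont : Tendsto (fun x : ℝ => mixExponent a S (x • t)) (𝓝[>] 1)
      (𝓝[≠] (mixExponent a S t)) := by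
    refine tendsto_nhdsWithin_iff.2 ⟨?_, ?_⟩
    · have : Continuous fun x : ℝ => mixExponent a S (x • t) := by
        simp_rw [mixExponent_smul]
        fun_prop
      simpa using (this.tendsto 1).mono_left nhdsWithin_le_nhds
    · filter_upwards [self_mem_nhdsWithin] with x (hx : 1 < x) heq
      have h1 := congrArg Complex.re heq
      have h2 := hre 1
      rw [one_smul] at h2
      rw [hre, h2] at h1
      nlinarith [mul_pos (show 0 < x ^ 2 - 1 by nlinarith) hq]
  exact hcont.frequently (Eventually.of_forall fun x => h _).frequently

lemma tendsto_complexMGF_of_tendsto {ι : Type*} {l : Filter ι} {μ : ι → ProbabilityMeasure ℝ}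
    {G : ProbabilityMeasure ℝ} (h : Tendsto μ l (𝓝 G))
    (hμ : ∀ᶠ i in l, (μ i : Measure ℝ) (Set.Iio 0) = 0) (hG : (G : Measure ℝ) (Set.Iio 0) = 0)
    {s : ℂ} (hs : s.re ≤ 0) :
    Tendsto (fun i => complexMGF id (μ i : Measure ℝ) s) l (𝓝 (complexMGF id (G : Measure ℝ) s)) := by
  rw [ProbabilityMeasure.tendsto_iff_forall_integral_rclike_tendsto ℂ] at h
  -- Replacing `z` by `max z 0` makes the integrand bounded on all of `ℝ`, without changing integrals.
  let g : BoundedContinuousFunction ℝ ℂ := BoundedContinuousFunction.ofNormedAddCommGroup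
    (fun z : ℝ => Complex.exp (s * (max z 0 : ℝ))) (by fun_prop) 1
    fun z => norm_cexp_mul_le_one hs (le_max_right z 0)
  have key : ∀ H : Measure ℝ, H (Set.Iio 0) = 0 → ∫ z, g z ∂H = complexMGF id H s := by
    intro H hH
    refine integral_congr_ae ?_
    filter_upwards [ae_nonneg_of_measure_Iio_eq_zero hH] with z hz
    simp [g, max_eq_left hz]
  have h1 := h g
  rw [key _ hG] at h1
  refine h1.congr' ?_
  filter_upwards [hμ] with i hi using key _ hi

/-! ### Normal variance-mean mixtures -/

/-- The normal variance-mean mixture, realized as the law of `c + z a + √z W` for independent `z ∼ G`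
and `W ∼ N(0, S)`. Only used for `G` carried by `[0, ∞)`; at negative `z` the square root is `0`. -/
noncomputable def mixtureLaw {m : ℕ} (c a : Vec m) (S : Matrix (Fin m) (Fin m) ℝ)
    (G : Measure ℝ) : Measure (Vec m) :=
  (G.prod (multivariateGaussian 0 S)).map fun p => c + p.1 • a + √p.1 • p.2

instance {m : ℕ} (c a : Vec m) (S : Matrix (Fin m) (Fin m) ℝ) (G : Measure ℝ)
    [IsProbabilityMeasure G] : IsProbabilityMeasure (mixtureLaw c a S G) :=
  Measure.isProbabilityMeasure_map (by fun_prop)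

lemma charFun_multivariateGaussian_smul {m : ℕ} {S : Matrix (Fin m) (Fin m) ℝ} (hS : S.PosSemidef)
    (c a : Vec m) {z : ℝ} (hz : 0 ≤ z) (t : Vec m) :
    charFun (multivariateGaussian (c + z • a) (z • S)) t
      = Complex.exp ((inner ℝ t c : ℝ) * Complex.I) * Complex.exp (mixExponent a S t * z) := by
  rw [charFun_multivariateGaussian (hS.smul hz), ← Complex.exp_add, mixExponent, inner_add_right,
    inner_smul_right, Matrix.smul_mulVec, dotProduct_smul]
  congr 1
  push_cast
  simp only [smul_eq_mul, Complex.ofReal_mul]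
  ring

lemma map_multivariateGaussian_zero {m : ℕ} {S : Matrix (Fin m) (Fin m) ℝ} (hS : S.PosSemidef)
    (c a : Vec m) {z : ℝ} (hz : 0 ≤ z) :
    (multivariateGaussian 0 S).map (fun w => c + z • a + √z • w)
      = multivariateGaussian (c + z • a) (z • S) := by
  have : IsProbabilityMeasure ((multivariateGaussian 0 S).map fun w => c + z • a + √z • w) :=
    Measure.isProbabilityMeasure_map (by fun_prop)
  refine Measure.ext_of_charFun (funext fun t => ?_)
  rw [charFun_multivariateGaussian_smul hS c a hz,
    show (fun w : Vec m => c + z • a + √z • w) = (fun w => c + z • a + w) ∘ (fun w => √z • w) from rfl,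
    ← Measure.map_map (by fun_prop) (by fun_prop), charFun_map_const_add, charFun_map_smul,
    charFun_multivariateGaussian hS, ← Complex.exp_add, ← Complex.exp_add, mixExponent]
  congr 1
  have h : ((√z : ℝ) : ℂ) * (√z : ℝ) = z := by
    rw [← Complex.ofReal_mul, Real.mul_self_sqrt hz]
  simp only [WithLp.ofLp_smul, Matrix.mulVec_smul, dotProduct_smul, smul_dotProduct, smul_eq_mul,
    inner_zero_right, real_inner_comm, inner_add_right, inner_smul_right]
  push_cast
  rw [← mul_assoc, h]
  ring

lemma isNormalMixture_iff {m : ℕ} {S : Matrix (Fin m) (Fin m) ℝ} (hS : S.PosSemidef) (c a : Vec m)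
    {G : Measure ℝ} [IsFiniteMeasure G] (hG : G (Set.Iio 0) = 0) (F : Measure (Vec m)) :
    IsNormalMixture c a S G F ↔ F = mixtureLaw c a S G := by
  have key : ∀ B, MeasurableSet B → mixtureLaw c a S G B
      = ∫⁻ z in Set.Ici (0 : ℝ), multivariateGaussian (c + z • a) (z • S) B ∂G := by
    intro B hB
    have hf : Measurable fun p : ℝ × Vec m => c + p.1 • a + √p.1 • p.2 := by fun_prop
    rw [mixtureLaw, Measure.map_apply hf hB, Measure.prod_apply (hf hB),
      Measure.restrict_eq_self_of_ae_mem (s := Set.Ici 0) (ae_nonneg_of_measure_Iio_eq_zero hG)]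
    refine lintegral_congr_ae ?_
    filter_upwards [ae_nonneg_of_measure_Iio_eq_zero hG] with z hz
    rw [← map_multivariateGaussian_zero hS c a hz, Measure.map_apply (by fun_prop) hB]
    rfl
  constructor
  · intro h
    ext B hB
    rw [h B hB, key B hB]
  · rintro rfl B hB
    exact key B hB

lemma charFun_mixtureLaw {m : ℕ} {S : Matrix (Fin m) (Fin m) ℝ} (hS : S.PosSemidef) (c a : Vec m)
    {G : Measure ℝ} [IsFiniteMeasure G] (hG : G (Set.Iio 0) = 0) (t : Vec m) :
    charFun (mixtureLaw c a S G) t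
      = Complex.exp ((inner ℝ t c : ℝ) * Complex.I) * complexMGF id G (mixExponent a S t) := by
  rw [charFun_apply, mixtureLaw, integral_map (by fun_prop) (by fun_prop), integral_prod]
  · rw [complexMGF, ← integral_const_mul]
    refine integral_congr_ae ?_
    filter_upwards [ae_nonneg_of_measure_Iio_eq_zero hG] with z hz
    rw [id, ← charFun_multivariateGaussian_smul hS c a hz, ← map_multivariateGaussian_zero hS c a hz,
      charFun_apply, integral_map (by fun_prop) (by fun_prop)]
  · refine Integrable.of_bound (by fun_prop) 1 (Eventually.of_forall fun p => ?_)
    rw [Complex.norm_exp_ofReal_mul_I]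

/-! ### Conditioning on the random sample size -/

/-- Fubini for a random index `N` that is independent of each `W k` separately: the expectation may be
split over the countably many events `{N = k}`. The index `0` is exempt, being attained with
probability `0`. -/
lemma integral_comp_randomIndex {Ω E : Type*} [MeasurableSpace Ω] [MeasurableSpace E]
    {P : Measure Ω} [IsProbabilityMeasure P] {N : Ω → ℕ} (hN : Measurable N)
    (hNpos : ∀ᵐ ω ∂P, 1 ≤ N ω) {W : ℕ → Ω → E} (hW : ∀ k, Measurable (W k))
    (hind : ∀ k, 1 ≤ k → IndepFun N (W k) P) {f : ℕ → E → ℂ} (hf : ∀ k, Measurable (f k))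
    {C : ℝ} (hC : ∀ k x, ‖f k x‖ ≤ C) :
    ∫ ω, f (N ω) (W (N ω) ω) ∂P = ∫ ω, (∫ ω', f (N ω) (W (N ω) ω') ∂P) ∂P := by
  have hmeas : Measurable fun ω => f (N ω) (W (N ω) ω) := by
    have : Measurable fun p : ℕ × Ω => f p.1 (W p.1 p.2) :=
      measurable_from_prod_countable_right fun k => (hf k).comp (hW k)
    exact this.comp (hN.prodMk measurable_id)
  have hint : Integrable (fun ω => f (N ω) (W (N ω) ω)) P :=
    Integrable.of_bound hmeas.aestronglyMeasurable C (Eventually.of_forall fun ω => hC _ _)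
  have hmeas' : Measurable fun ω => ∫ ω', f (N ω) (W (N ω) ω') ∂P :=
    (measurable_of_countable fun k : ℕ => ∫ ω', f k (W k ω') ∂P).comp hN
  have hint' : Integrable (fun ω => ∫ ω', f (N ω) (W (N ω) ω') ∂P) P := by
    refine Integrable.of_bound hmeas'.aestronglyMeasurable C (Eventually.of_forall fun ω => ?_)
    simpa using norm_integral_le_of_norm_le_const (μ := P)
      (Eventually.of_forall fun ω' => hC (N ω) (W (N ω) ω'))
  have hfib : ∀ k, MeasurableSet (N ⁻¹' {k}) := fun k => hN (measurableSet_singleton k)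
  have huniv : (⋃ k, N ⁻¹' {k}) = Set.univ := by ext; simp
  have hdisj : Pairwise (Function.onFun Disjoint fun k => N ⁻¹' {k}) :=
    fun i j hij => Disjoint.preimage N (by simpa using hij)
  rw [← setIntegral_univ, ← huniv, integral_iUnion hfib hdisj hint.integrableOn,
    ← setIntegral_univ (f := fun ω => ∫ ω', f (N ω) (W (N ω) ω') ∂P), ← huniv,
    integral_iUnion hfib hdisj hint'.integrableOn]
  refine tsum_congr fun k => ?_
  have hleft : ∫ ω in N ⁻¹' {k}, f (N ω) (W (N ω) ω) ∂P = ∫ ω in N ⁻¹' {k}, f k (W k ω) ∂P :=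
    setIntegral_congr_fun (hfib k) fun ω (hω : N ω = k) => by subst hω; rfl
  have hright : ∫ ω in N ⁻¹' {k}, (∫ ω', f (N ω) (W (N ω) ω') ∂P) ∂P
      = ∫ _ in N ⁻¹' {k}, (∫ ω', f k (W k ω') ∂P) ∂P :=
    setIntegral_congr_fun (hfib k) fun ω (hω : N ω = k) => by subst hω; rfl
  rw [hleft, hright, setIntegral_const]
  rcases Nat.eq_zero_or_pos k with rfl | hk
  · have h0 : P (N ⁻¹' {0}) = 0 := by
      rw [← nonpos_iff_eq_zero, ← show P {ω | ¬ 1 ≤ N ω} = 0 from hNpos]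
      refine measure_mono fun ω (hω : N ω = 0) => ?_
      change ¬ 1 ≤ N ω
      omega
    rw [Measure.restrict_eq_zero.2 h0]
    simp [Measure.real, h0]
  · exact Indep.setIntegral_eq_smul hN.comap_le ((IndepFun_iff_Indep _ _ _).1 (hind k hk))
      (hW k).aemeasurable ⟨{k}, measurableSet_singleton k, rfl⟩ (hf k).aestronglyMeasurable

lemma measurable_statistic {Ω : Type*} [MeasurableSpace Ω] {r m : ℕ}
    {X : ℕ → ℕ → Ω → Vec r} (hX : ∀ n j, Measurable (X n j))
    {T : ∀ _n k : ℕ, (Fin k → Vec r) → Vec m} (hT : ∀ n k, Measurable (T n k)) (n k : ℕ) :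
    Measurable (statistic T X n k) :=
  (hT n k).comp (measurable_pi_lambda _ fun j => hX n j)

lemma measurable_normalized {Ω : Type*} [MeasurableSpace Ω] {r m : ℕ}
    {X : ℕ → ℕ → Ω → Vec r} (hX : ∀ n j, Measurable (X n j))
    {T : ∀ _n k : ℕ, (Fin k → Vec r) → Vec m} (hT : ∀ n k, Measurable (T n k))
    (θ : ℕ → Vec m) (σ : ℕ → ℝ) (a : ℕ → Vec m) (n k : ℕ) :
    Measurable (normalized T X θ σ a n k) :=
  (((measurable_statistic hX hT n k).sub_const (θ n)).sub_const (center σ a n k)).const_smul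
    (scale σ n k)⁻¹

lemma measurable_randomNormalized {Ω : Type*} [MeasurableSpace Ω] {r m : ℕ}
    {X : ℕ → ℕ → Ω → Vec r} (hX : ∀ n j, Measurable (X n j))
    {T : ∀ _n k : ℕ, (Fin k → Vec r) → Vec m} (hT : ∀ n k, Measurable (T n k))
    {N : ℕ → Ω → ℕ} (hN : ∀ n, Measurable (N n)) (θ : ℕ → Vec m) (σ : ℕ → ℝ) (b : ℕ → Vec m)
    (n : ℕ) : Measurable (randomNormalized T X N θ σ b n) := by
  have h : Measurable fun p : ℕ × Ω => statistic T X n p.1 p.2 :=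
    measurable_from_prod_countable_right fun k => measurable_statistic hX hT n k
  have h' : Measurable (randomStatistic T X N n) := h.comp ((hN n).prodMk measurable_id)
  exact ((h'.sub_const (θ n)).const_smul (σ n * √(n : ℝ))).sub_const (b n)

/-- For sample size `k`, the statistic centered and scaled with `n` equals
`(n/k) a_n - c + √(n/k) Y_{n,k}`. -/
lemma smul_statistic_sub_eq {Ω : Type*} {r m : ℕ} (T : ∀ _n k : ℕ, (Fin k → Vec r) → Vec m)
    (X : ℕ → ℕ → Ω → Vec r) (θ : ℕ → Vec m) (σ : ℕ → ℝ) (a : ℕ → Vec m) (c : Vec m)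
    {n k : ℕ} (hk : 1 ≤ k) (hσ : 0 < σ n) (ω : Ω) :
    (σ n * √(n : ℝ)) • (statistic T X n k ω - θ n) - c
      = (((n : ℝ) / k) • a n - c) + √((n : ℝ) / k) • normalized T X θ σ a n k ω := by
  have hk' : (0 : ℝ) < k := by exact_mod_cast hk
  have hs : √(k : ℝ) ≠ 0 := (Real.sqrt_pos.2 hk').ne'
  have hkk : √(k : ℝ) * √(k : ℝ) = k := Real.mul_self_sqrt hk'.le
  have hnn : √(n : ℝ) * √(n : ℝ) = n := Real.mul_self_sqrt n.cast_nonneg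
  have h1 : √((n : ℝ) / k) * (σ n * √(k : ℝ)) = σ n * √(n : ℝ) := by
    rw [Real.sqrt_div n.cast_nonneg]
    field_simp
  have h2 : σ n * √(n : ℝ) * ((σ n * (k : ℝ))⁻¹ * √(n : ℝ)) = (n : ℝ) / k := by
    have := hσ.ne'
    field_simp
    rw [pow_two, hnn]
  rw [normalized, scale, inv_inv, center, smul_smul, h1, smul_sub _ (_ - _), smul_smul, h2]
  abel

/-- The characteristic function of the statistic with random sample size, as an average over `N_n` of
the characteristic functions `h_{n,k}` of the statistics with non-random sample size. -/
lemma charFun_map_randomNormalized {Ω : Type*} [MeasurableSpace Ω] {P : Measure Ω}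
    [IsProbabilityMeasure P] {r m : ℕ}
    {X : ℕ → ℕ → Ω → Vec r} (hX : ∀ n j, Measurable (X n j))
    {T : ∀ _n k : ℕ, (Fin k → Vec r) → Vec m} (hT : ∀ n k, Measurable (T n k))
    {N : ℕ → Ω → ℕ} (hN : ∀ n, Measurable (N n)) {θ : ℕ → Vec m} {σ : ℕ → ℝ}
    (a b : ℕ → Vec m) {n : ℕ} (hNpos : ∀ᵐ ω ∂P, 1 ≤ N n ω)
    (hNindep : ∀ k, 1 ≤ k → IndepFun (N n) (statistic T X n k) P) (hσ : 0 < σ n) (t : Vec m) :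
    charFun (P.map (randomNormalized T X N θ σ b n)) t
      = ∫ ω, Complex.exp (((inner ℝ (a n) t * ((n : ℝ) / N n ω) - inner ℝ (b n) t : ℝ)) * Complex.I) *
          charFun (P.map (normalized T X θ σ a n (N n ω))) (√((n : ℝ) / N n ω) • t) ∂P := by
  rw [charFun_apply, integral_map (measurable_randomNormalized hX hT hN θ σ b n).aemeasurable
    (by fun_prop)]
  have h := integral_comp_randomIndex (P := P) (hN n) hNpos (measurable_statistic hX hT n) hNindep
    (f := fun _ x => Complex.exp
      ((inner ℝ ((σ n * √(n : ℝ)) • (x - θ n) - b n) t : ℝ) * Complex.I))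
    (fun _ => by fun_prop) (C := 1) (fun _ x => by rw [Complex.norm_exp_ofReal_mul_I])
  refine h.trans (integral_congr_ae ?_)
  filter_upwards [hNpos] with ω hω
  rw [charFun_apply, integral_map (measurable_normalized hX hT θ σ a n _).aemeasurable (by fun_prop),
    ← integral_const_mul]
  refine integral_congr_ae (Eventually.of_forall fun ω' => ?_)
  simp only
  rw [smul_statistic_sub_eq T X θ σ a (b n) hω hσ ω', ← Complex.exp_add, inner_add_left,
    inner_sub_left, real_inner_smul_left, real_inner_smul_left, real_inner_smul_right]
  congr 1
  push_cast
  ring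

/-! ### Comparison of the characteristic functions -/

lemma norm_exp_ofReal_mul_I_sub_le (x y : ℝ) :
    ‖Complex.exp (x * Complex.I) - Complex.exp (y * Complex.I)‖ ≤ |x - y| := by
  have h : Complex.exp (x * Complex.I) - Complex.exp (y * Complex.I)
      = Complex.exp (y * Complex.I) * (Complex.exp (Complex.I * (x - y : ℝ)) - 1) := by
    rw [mul_sub, ← Complex.exp_add, mul_one]
    congr 2
    push_cast
    ring
  rw [h, norm_mul, Complex.norm_exp_ofReal_mul_I, one_mul]
  exact Real.norm_exp_I_mul_ofReal_sub_one_le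

lemma norm_normalCharFun_le_one {m : ℕ} {S : Matrix (Fin m) (Fin m) ℝ} (hS : S.PosSemidef)
    (t : Vec m) : ‖normalCharFun S t‖ ≤ 1 := by
  rw [normalCharFun, Complex.norm_exp, Complex.ofReal_re, Real.exp_le_one_iff]
  linarith [quadForm_nonneg hS t]

/-- Polar form of `exp (v e(t))`, parallel to the integrand in `charFun_map_randomNormalized`. -/
lemma cexp_mixExponent_mul {m : ℕ} (a : Vec m) (S : Matrix (Fin m) (Fin m) ℝ) (t : Vec m) {v : ℝ}
    (hv : 0 ≤ v) : Complex.exp (mixExponent a S t * v)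
      = Complex.exp ((inner ℝ a t * v : ℝ) * Complex.I) * normalCharFun S (√v • t) := by
  have h : ((√v : ℝ) : ℂ) * (√v : ℝ) = v := by
    rw [← Complex.ofReal_mul, Real.mul_self_sqrt hv]
  rw [normalCharFun, ← Complex.exp_add, mixExponent, real_inner_comm]
  simp only [WithLp.ofLp_smul, Matrix.mulVec_smul, dotProduct_smul, smul_dotProduct, smul_eq_mul]
  congr 1
  push_cast
  rw [← mul_assoc (√v : ℂ), h]
  ring

lemma norm_charFun_sub_normalCharFun_le {m : ℕ} {S : Matrix (Fin m) (Fin m) ℝ} (hS : S.PosSemidef)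
    (μ : Measure (Vec m)) [IsProbabilityMeasure μ] (t : Vec m) :
    ‖charFun μ t - normalCharFun S t‖ ≤ 2 :=
  (norm_sub_le _ _).trans
    (by linarith [norm_charFun_le_one (μ := μ) t, norm_normalCharFun_le_one hS t])

lemma norm_phase_mul_sub_le (x y : ℝ) {h ψ : ℂ} (hψ : ‖ψ‖ ≤ 1) :
    ‖Complex.exp (x * Complex.I) * h - Complex.exp (y * Complex.I) * ψ‖ ≤ |x - y| + ‖h - ψ‖ := by
  have e : Complex.exp (x * Complex.I) * h - Complex.exp (y * Complex.I) * ψ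
      = (Complex.exp (x * Complex.I) - Complex.exp (y * Complex.I)) * ψ
        + Complex.exp (x * Complex.I) * (h - ψ) := by ring
  rw [e]
  refine (norm_add_le _ _).trans (add_le_add ?_ ?_)
  · rw [norm_mul]
    exact (mul_le_of_le_one_right (norm_nonneg _) hψ).trans (norm_exp_ofReal_mul_I_sub_le x y)
  · rw [norm_mul, Complex.norm_exp_ofReal_mul_I, one_mul]

/-- The characteristic function of the normalized statistic is asymptotically equal to the transform
of the law of `n / N_n` that a normal mixture with this mixing law would have. -/
lemma tendsto_charFun_sub_complexMGF {Ω : Type*} [MeasurableSpace Ω] {P : Measure Ω}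
    [IsProbabilityMeasure P] {r m : ℕ}
    {X : ℕ → ℕ → Ω → Vec r} (hX : ∀ n j, Measurable (X n j))
    {T : ∀ _n k : ℕ, (Fin k → Vec r) → Vec m} (hT : ∀ n k, Measurable (T n k))
    {N : ℕ → Ω → ℕ} (hN : ∀ n, Measurable (N n)) (hNpos : ∀ n, 1 ≤ n → ∀ᵐ ω ∂P, 1 ≤ N n ω)
    (hNindep : ∀ n k, 1 ≤ n → 1 ≤ k → IndepFun (N n) (statistic T X n k) P)
    {θ : ℕ → Vec m} {σ : ℕ → ℝ} (hσ : ∀ n, 1 ≤ n → 0 < σ n)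
    {a b : ℕ → Vec m} {a₀ b₀ : Vec m} (ha : Tendsto a atTop (𝓝 a₀)) (hb : Tendsto b atTop (𝓝 b₀))
    (htight : IsTightMeasureSet
      ((fun n : ℕ => P.map (fun ω => (n : ℝ) / (N n ω : ℝ))) '' Set.Ici 1))
    {S : Matrix (Fin m) (Fin m) ℝ} (hS : S.PosSemidef)
    (hnormal : AsymptoticallyNormal P (normalized T X θ σ a) N S) (t : Vec m) :
    Tendsto (fun n : ℕ => charFun (P.map (randomNormalized T X N θ σ b n)) t
      - Complex.exp ((inner ℝ t (-b₀) : ℝ) * Complex.I) *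
        complexMGF id (P.map fun ω => (n : ℝ) / (N n ω : ℝ)) (mixExponent a₀ S t)) atTop (𝓝 0) := by
  have hV : ∀ n : ℕ, Measurable fun ω => (n : ℝ) / (N n ω : ℝ) := fun n =>
    (measurable_of_countable fun k : ℕ => (n : ℝ) / (k : ℝ)).comp (hN n)
  have hprob : ∀ n k, IsProbabilityMeasure (P.map (normalized T X θ σ a n k)) := fun n k =>
    Measure.isProbabilityMeasure_map (measurable_normalized hX hT θ σ a n k).aemeasurable
  have hsup2 : ∀ (R : ℝ) n k, BddAbove (Set.range fun u : Metric.closedBall (0 : Vec m) R =>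
      ‖charFun (P.map (normalized T X θ σ a n k)) (u : Vec m) - normalCharFun S (u : Vec m)‖) :=
    fun R n k => ⟨2, by
      rintro _ ⟨u, rfl⟩
      exact norm_charFun_sub_normalCharFun_le hS _ _⟩
  rw [Metric.tendsto_atTop']
  intro ε hε
  -- Outside `{V ≤ K}` the integrand is at most `2`, and that event has probability at most `ε / 8`.
  obtain ⟨K, hK0, hK⟩ : ∃ K : ℝ, 0 < K ∧ ∀ n : ℕ, 1 ≤ n →
      P.real {ω | K < (n : ℝ) / (N n ω : ℝ)} ≤ ε / 8 := by
    have h := tendsto_measure_norm_gt_of_isTightMeasureSet htight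
    have h8 : (0 : ENNReal) < ENNReal.ofReal (ε / 8) := by
      rw [ENNReal.ofReal_pos]; positivity
    obtain ⟨K, hK, hK0⟩ := ((h.eventually_le_const h8).and (eventually_gt_atTop 0)).exists
    refine ⟨K, hK0, fun n hn => ENNReal.toReal_le_of_le_ofReal (by positivity) ?_⟩
    have hle := (iSup₂_le_iff.1 hK) _ (Set.mem_image_of_mem _ (Set.mem_Ici.2 hn))
    refine le_trans ?_ hle
    rw [Measure.map_apply (hV n) (measurableSet_lt measurable_const measurable_norm)]
    exact measure_mono fun ω (hω : K < (n : ℝ) / N n ω) => hω.trans_le (le_abs_self _)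
  -- The radius contains `√V t` as soon as `V ≤ K`; adding `1` makes it positive also for `t = 0`.
  set R : ℝ := √K * ‖t‖ + 1 with hR
  have hR0 : 0 < R := by positivity
  have hlim : Tendsto (fun n : ℕ => |inner ℝ (a n - a₀) t| * K + |inner ℝ (b n - b₀) t| +
      (∫ ω, (⨆ u : Metric.closedBall (0 : Vec m) R,
        ‖charFun (P.map (normalized T X θ σ a n (N n ω))) (u : Vec m)
          - normalCharFun S (u : Vec m)‖) ∂P)) atTop (𝓝 0) := by
    have h1 : Tendsto (fun n => |inner ℝ (a n - a₀) t|) atTop (𝓝 0) := by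
      have := ((ha.sub_const a₀).inner (tendsto_const_nhds (x := t)) (𝕜 := ℝ)).abs
      simpa using this
    have h2 : Tendsto (fun n => |inner ℝ (b n - b₀) t|) atTop (𝓝 0) := by
      have := ((hb.sub_const b₀).inner (tendsto_const_nhds (x := t)) (𝕜 := ℝ)).abs
      simpa using this
    simpa using ((h1.mul_const K).add h2).add (hnormal R hR0)
  obtain ⟨n₀, hn₀⟩ := eventually_atTop.1 (hlim.eventually_lt_const (half_pos hε))
  refine ⟨max n₀ 1, fun n hn => ?_⟩
  have hn1 : 1 ≤ n := ((le_max_right _ _).trans_lt hn).le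
  have hn2 := hn₀ n ((le_max_left _ _).trans_lt hn).le
  rw [dist_zero_right, charFun_map_randomNormalized hX hT hN a b (hNpos n hn1)
    (fun k hk => hNindep n k hn1 hk) (hσ n hn1), complexMGF_id_map (hV n).aemeasurable, complexMGF,
    ← integral_const_mul]
  set g : ℕ → ℝ := fun k => ⨆ u : Metric.closedBall (0 : Vec m) R,
    ‖charFun (P.map (normalized T X θ σ a n k)) (u : Vec m) - normalCharFun S (u : Vec m)‖ with hg
  have hg0 : ∀ k, 0 ≤ g k := fun k => Real.iSup_nonneg fun u => norm_nonneg _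
  have hg2 : ∀ k, g k ≤ 2 := fun k => Real.iSup_le
    (fun u => norm_charFun_sub_normalCharFun_le hS _ _) zero_le_two
  have hgm : Measurable fun ω => g (N n ω) := (measurable_of_countable g).comp (hN n)
  have hgi : Integrable (fun ω => g (N n ω)) P :=
    Integrable.of_bound hgm.aestronglyMeasurable 2 (Eventually.of_forall fun ω => by
      rw [Real.norm_of_nonneg (hg0 _)]; exact hg2 _)
  have hset : MeasurableSet {ω | K < (n : ℝ) / (N n ω : ℝ)} :=
    measurableSet_lt measurable_const (hV n)
  have hi1 : Integrable (fun ω => Complex.exp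
      (((inner ℝ (a n) t * ((n : ℝ) / N n ω) - inner ℝ (b n) t : ℝ)) * Complex.I) *
      charFun (P.map (normalized T X θ σ a n (N n ω))) (√((n : ℝ) / N n ω) • t)) P := by
    refine Integrable.of_bound (Measurable.aestronglyMeasurable ?_) 1
      (Eventually.of_forall fun ω => ?_)
    · exact (measurable_of_countable fun k : ℕ => Complex.exp
        (((inner ℝ (a n) t * ((n : ℝ) / k) - inner ℝ (b n) t : ℝ)) * Complex.I) *
        charFun (P.map (normalized T X θ σ a n k)) (√((n : ℝ) / k) • t)).comp (hN n)
    · rw [norm_mul, Complex.norm_exp_ofReal_mul_I, one_mul]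
      exact norm_charFun_le_one _
  have hVnn : ∀ ω, 0 ≤ (n : ℝ) / (N n ω : ℝ) := fun ω => by positivity
  have hi2 : Integrable (fun ω => Complex.exp ((inner ℝ t (-b₀) : ℝ) * Complex.I) *
      Complex.exp (mixExponent a₀ S t * ((n : ℝ) / (N n ω : ℝ) : ℝ))) P := by
    refine Integrable.of_bound (Measurable.aestronglyMeasurable ?_) 1
      (Eventually.of_forall fun ω => ?_)
    · have := hV n
      fun_prop
    · rw [norm_mul, Complex.norm_exp_ofReal_mul_I, one_mul]
      exact norm_cexp_mul_le_one (mixExponent_re_nonpos a₀ hS t) (hVnn ω)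
  rw [← integral_sub hi1 hi2]
  have hbound : ∀ ω, ‖Complex.exp
      (((inner ℝ (a n) t * ((n : ℝ) / N n ω) - inner ℝ (b n) t : ℝ)) * Complex.I) *
      charFun (P.map (normalized T X θ σ a n (N n ω))) (√((n : ℝ) / N n ω) • t) -
      Complex.exp ((inner ℝ t (-b₀) : ℝ) * Complex.I) *
      Complex.exp (mixExponent a₀ S t * ((n : ℝ) / (N n ω : ℝ) : ℝ))‖ ≤
      |inner ℝ (a n - a₀) t| * K + |inner ℝ (b n - b₀) t| + g (N n ω)
        + {ω | K < (n : ℝ) / (N n ω : ℝ)}.indicator (fun _ => (2 : ℝ)) ω := by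
    intro ω
    have hψ := norm_normalCharFun_le_one hS (√((n : ℝ) / N n ω) • t)
    have hh := norm_charFun_le_one (μ := P.map (normalized T X θ σ a n (N n ω)))
      (√((n : ℝ) / N n ω) • t)
    rw [cexp_mixExponent_mul a₀ S t (hVnn ω), ← mul_assoc, ← Complex.exp_add, ← add_mul,
      ← Complex.ofReal_add]
    set v := (n : ℝ) / (N n ω : ℝ) with hv
    by_cases hω : K < v
    · rw [Set.indicator_of_mem (show ω ∈ {ω | K < (n : ℝ) / (N n ω : ℝ)} from hω)]
      refine (norm_sub_le _ _).trans ?_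
      rw [norm_mul, norm_mul, Complex.norm_exp_ofReal_mul_I, Complex.norm_exp_ofReal_mul_I]
      have h1 := mul_nonneg (abs_nonneg (inner ℝ (a n - a₀) t)) hK0.le
      have h2 := abs_nonneg (inner ℝ (b n - b₀) t)
      linarith [hg0 (N n ω)]
    · rw [Set.indicator_of_notMem (show ω ∉ {ω | K < (n : ℝ) / (N n ω : ℝ)} from hω), add_zero]
      refine (norm_phase_mul_sub_le _ _ hψ).trans (add_le_add ?_ ?_)
      · have e : inner ℝ (a n) t * v - inner ℝ (b n) t - (inner ℝ t (-b₀) + inner ℝ a₀ t * v)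
            = inner ℝ (a n - a₀) t * v - inner ℝ (b n - b₀) t := by
          rw [inner_neg_right, real_inner_comm b₀ t, inner_sub_left, inner_sub_left]
          ring
        rw [e]
        refine (abs_sub _ _).trans (add_le_add_left ?_ _)
        rw [abs_mul, abs_of_nonneg (hVnn ω)]
        exact mul_le_mul_of_nonneg_left (not_lt.1 hω) (abs_nonneg _)
      · refine le_ciSup (hsup2 R n (N n ω)) ⟨√v • t, ?_⟩
        rw [mem_closedBall_zero_iff, norm_smul, Real.norm_of_nonneg (Real.sqrt_nonneg _), hR]
        have := mul_le_mul_of_nonneg_right (Real.sqrt_le_sqrt (not_lt.1 hω)) (norm_nonneg t)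
        linarith
  have hi3 : Integrable (fun ω => |inner ℝ (a n - a₀) t| * K + |inner ℝ (b n - b₀) t| + g (N n ω)) P :=
    (integrable_const _).add hgi
  have hi4 : Integrable ({ω | K < (n : ℝ) / (N n ω : ℝ)}.indicator fun _ => (2 : ℝ)) P :=
    (integrable_const _).indicator hset
  calc _ ≤ _ := norm_integral_le_of_norm_le (hi3.add hi4) (Eventually.of_forall hbound)
    _ < ε := by
      simp only [Pi.add_apply]
      rw [integral_add hi3 hi4, integral_add (integrable_const _) hgi, integral_const,
        integral_indicator_const _ hset]
      simp only [probReal_univ, smul_eq_mul, one_mul]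
      linarith [hK n hn1]

/-! ### Convergence of the mixing laws -/

/-- Lévy-type continuity theorem for mixing laws: a tight sequence of laws on `[0, ∞)` whose transforms
converge along `mixExponent a S` converges weakly. By Prokhorov's theorem it converges along every
ultrafilter finer than `atTop`, and identifiability makes all these limits equal. -/
lemma exists_tendsto_of_tendsto_complexMGF {m : ℕ} (hm : 1 ≤ m) (a : Vec m)
    {S : Matrix (Fin m) (Fin m) ℝ} (hS : S.PosDef) {μ : ℕ → ProbabilityMeasure ℝ}
    (hμ : ∀ n, (μ n : Measure ℝ) (Set.Iio 0) = 0)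
    (htight : IsTightMeasureSet ((fun n => (μ n : Measure ℝ)) '' Set.Ici 1)) {φ : Vec m → ℂ}
    (h : ∀ t, Tendsto (fun n => complexMGF id (μ n : Measure ℝ) (mixExponent a S t)) atTop
      (𝓝 (φ t))) :
    ∃ G : ProbabilityMeasure ℝ, (G : Measure ℝ) (Set.Iio 0) = 0 ∧ Tendsto μ atTop (𝓝 G) ∧
      ∀ t, complexMGF id (G : Measure ℝ) (mixExponent a S t) = φ t := by
  have hcompact : IsCompact (closure (μ '' Set.Ici 1)) := by
    refine isCompact_closure_of_isTightMeasureSet ?_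
    convert! htight using 1
    ext ν
    simp
  have hex : ∀ U : Ultrafilter ℕ, (U : Filter ℕ) ≤ atTop → ∃ G : ProbabilityMeasure ℝ,
      (G : Measure ℝ) (Set.Iio 0) = 0 ∧ Tendsto μ U (𝓝 G) ∧
      ∀ t, complexMGF id (G : Measure ℝ) (mixExponent a S t) = φ t := by
    intro U hU
    obtain ⟨G, -, hG⟩ := hcompact.ultrafilter_le_nhds (U.map μ) <| by
      refine le_trans ?_ (principal_mono.2 subset_closure)
      rw [le_principal_iff]
      exact hU (mem_of_superset (Ici_mem_atTop 1) (Set.subset_preimage_image μ _))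
    have hG' : Tendsto μ U (𝓝 G) := hG
    have hG0 : (G : Measure ℝ) (Set.Iio 0) = 0 := by
      have := ProbabilityMeasure.le_liminf_measure_open_of_tendsto hG' (isOpen_Iio (a := (0 : ℝ)))
      simpa [hμ] using this
    refine ⟨G, hG0, hG', fun t => tendsto_nhds_unique ?_ ((h t).mono_left hU)⟩
    exact tendsto_complexMGF_of_tendsto hG' (Eventually.of_forall hμ) hG0
      (mixExponent_re_nonpos a hS.posSemidef t)
  obtain ⟨G, hG0, -, hGφ⟩ := hex (hyperfilter ℕ) Nat.hyperfilter_le_atTop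
  refine ⟨G, hG0, (tendsto_iff_ultrafilter _ _ _).2 fun U hU => ?_, hGφ⟩
  obtain ⟨G', hG0', hG', hGφ'⟩ := hex U hU
  have heq : (G : Measure ℝ) = G' := eq_of_complexMGF_mixExponent_eq hm a hS hG0 hG0' fun t => by
    rw [hGφ, hGφ']
  rwa [Subtype.ext heq]

end RandomSize

open RandomSize

theorem theorem3 {Ω : Type*} [MeasurableSpace Ω] (P : Measure Ω) [IsProbabilityMeasure P]
    (r m : ℕ) (hr : 1 ≤ r) (hm : 1 ≤ m)
    -- the row-wise independent observations and the statistic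
    (X : ℕ → ℕ → Ω → RandomSize.Vec r) (hX : ∀ n j, Measurable (X n j))
    (hXindep : ∀ n, 1 ≤ n → iIndepFun (X n) P)
    (T : ∀ _n k : ℕ, (Fin k → RandomSize.Vec r) → RandomSize.Vec m)
    (hT : ∀ n k, Measurable (T n k))
    -- the random sample sizes
    (N : ℕ → Ω → ℕ) (hN : ∀ n, Measurable (N n))
    (hNpos : ∀ n, 1 ≤ n → ∀ᵐ ω ∂P, 1 ≤ N n ω)
    (hNindep : ∀ n k, 1 ≤ n → 1 ≤ k → IndepFun (N n) (RandomSize.statistic T X n k) P)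
    -- the normalizing constants
    (θ : ℕ → RandomSize.Vec m) (σ : ℕ → ℝ) (hσ : ∀ n, 1 ≤ n → 0 < σ n)
    (a b : ℕ → RandomSize.Vec m) (a₀ b₀ : RandomSize.Vec m)
    (ha : Tendsto a atTop (𝓝 a₀)) (hb : Tendsto b atTop (𝓝 b₀))
    -- tightness of `n / N_n`
    (htight : IsTightMeasureSet
      ((fun n : ℕ => P.map (fun ω => (n : ℝ) / (N n ω : ℝ))) '' Set.Ici 1))
    -- asymptotic normality
    (S : Matrix (Fin m) (Fin m) ℝ) (hS : S.PosDef)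
    (hnormal : RandomSize.AsymptoticallyNormal P (RandomSize.normalized T X θ σ a) N S) :
    -- existence of a limit law
    ((∃ (F : Measure (RandomSize.Vec m)) (_ : IsProbabilityMeasure F),
        TendstoInDistribution (RandomSize.randomNormalized T X N θ σ b) atTop id (fun _ => P) F) ↔
      ∃ (G : Measure ℝ) (_ : IsProbabilityMeasure G), G (Set.Iio 0) = 0 ∧
        TendstoInDistribution (fun (n : ℕ) ω => (n : ℝ) / (N n ω : ℝ)) atTop id (fun _ => P) G) ∧
    -- a given law `F` is the limit law if and only if it is the corresponding mixture
    (∀ (F : Measure (RandomSize.Vec m)) [IsProbabilityMeasure F],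
      TendstoInDistribution (RandomSize.randomNormalized T X N θ σ b) atTop id (fun _ => P) F ↔
      ∃ (G : Measure ℝ) (_ : IsProbabilityMeasure G), G (Set.Iio 0) = 0 ∧
        RandomSize.IsNormalMixture (-b₀) a₀ S G F ∧
        TendstoInDistribution (fun (n : ℕ) ω => (n : ℝ) / (N n ω : ℝ)) atTop id (fun _ => P) G) := by
  have hS' := hS.posSemidef
  have hV : ∀ n : ℕ, Measurable fun ω => (n : ℝ) / (N n ω : ℝ) := fun n =>
    (measurable_of_countable fun k : ℕ => (n : ℝ) / (k : ℝ)).comp (hN n)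
  have hZ := measurable_randomNormalized hX hT hN θ σ b
  have hkey := tendsto_charFun_sub_complexMGF hX hT hN hNpos hNindep hσ ha hb htight hS' hnormal
  let μ : ℕ → ProbabilityMeasure ℝ := fun n =>
    ⟨P.map fun ω => (n : ℝ) / (N n ω : ℝ), Measure.isProbabilityMeasure_map (hV n).aemeasurable⟩
  have hμ : ∀ n, (μ n : Measure ℝ) (Set.Iio 0) = 0 := fun n => by
    simp only [μ, ProbabilityMeasure.coe_mk]
    rw [Measure.map_apply (hV n) measurableSet_Iio]
    have : (fun ω => (n : ℝ) / (N n ω : ℝ)) ⁻¹' Set.Iio 0 = ∅ :=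
      Set.eq_empty_of_forall_notMem fun ω hω =>
        absurd (show (n : ℝ) / (N n ω : ℝ) < 0 from hω)
          (not_lt.2 (by positivity))
    rw [this, measure_empty]
  have hphase : ∀ t : Vec m, Complex.exp ((inner ℝ t (-b₀) : ℝ) * Complex.I) ≠ 0 :=
    fun t => Complex.exp_ne_zero _
  have hVG : ∀ (G : Measure ℝ) [IsProbabilityMeasure G],
      TendstoInDistribution (fun (n : ℕ) ω => (n : ℝ) / (N n ω : ℝ)) atTop id (fun _ => P) G ↔
        Tendsto μ atTop (𝓝 ⟨G, inferInstance⟩) := by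
    intro G _
    refine ⟨fun h => by simpa using h.tendsto, fun h => ⟨fun n => (hV n).aemeasurable,
      aemeasurable_id, by simpa using h⟩⟩
  have hZF : ∀ (F : Measure (Vec m)) [IsProbabilityMeasure F],
      TendstoInDistribution (randomNormalized T X N θ σ b) atTop id (fun _ => P) F ↔
        ∀ t, Tendsto (fun n => charFun (P.map (randomNormalized T X N θ σ b n)) t) atTop
          (𝓝 (charFun F t)) := by
    intro F _
    constructor
    · intro h
      simpa using ProbabilityMeasure.tendsto_iff_tendsto_charFun.1 h.tendsto
    · intro h
      refine ⟨fun n => (hZ n).aemeasurable, aemeasurable_id, ?_⟩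
      exact ProbabilityMeasure.tendsto_iff_tendsto_charFun.2 (by simpa using h)
  -- A limit law of `n / N_n` yields the mixture as limit law of the normalized statistic.
  have hback : ∀ (G : Measure ℝ) [IsProbabilityMeasure G], G (Set.Iio 0) = 0 →
      TendstoInDistribution (fun (n : ℕ) ω => (n : ℝ) / (N n ω : ℝ)) atTop id (fun _ => P) G →
      TendstoInDistribution (randomNormalized T X N θ σ b) atTop id (fun _ => P)
        (mixtureLaw (-b₀) a₀ S G) := by
    intro G _ hG h
    refine (hZF _).2 fun t => ?_
    rw [charFun_mixtureLaw hS' _ _ hG]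
    have h1 := tendsto_complexMGF_of_tendsto ((hVG G).1 h) (Eventually.of_forall hμ) hG
      (mixExponent_re_nonpos a₀ hS' t)
    simpa [μ] using (hkey t).add (h1.const_mul (Complex.exp ((inner ℝ t (-b₀) : ℝ) * Complex.I)))
  -- A limit law of the normalized statistic yields a limit law of `n / N_n`, and is its mixture.
  have hforw : ∀ (F : Measure (Vec m)) [IsProbabilityMeasure F],
      TendstoInDistribution (randomNormalized T X N θ σ b) atTop id (fun _ => P) F →
      ∃ (G : Measure ℝ) (_ : IsProbabilityMeasure G), G (Set.Iio 0) = 0 ∧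
        IsNormalMixture (-b₀) a₀ S G F ∧
        TendstoInDistribution (fun (n : ℕ) ω => (n : ℝ) / (N n ω : ℝ)) atTop id (fun _ => P) G := by
    intro F _ h
    obtain ⟨G, hG0, hG, hGφ⟩ := exists_tendsto_of_tendsto_complexMGF hm a₀ hS hμ htight
      (φ := fun t => (Complex.exp ((inner ℝ t (-b₀) : ℝ) * Complex.I))⁻¹ * charFun F t) fun t => by
        have h1 := (((hZF F).1 h t).sub (hkey t)).const_mul
          (Complex.exp ((inner ℝ t (-b₀) : ℝ) * Complex.I))⁻¹
        simpa only [sub_sub_cancel, sub_zero, inv_mul_cancel_left₀ (hphase t), μ,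
          ProbabilityMeasure.coe_mk] using h1
    refine ⟨G, inferInstance, hG0, (isNormalMixture_iff hS' _ _ hG0 F).2 ?_, (hVG G).2 hG⟩
    refine Measure.ext_of_charFun (funext fun t => ?_)
    rw [charFun_mixtureLaw hS' _ _ hG0, hGφ, mul_inv_cancel_left₀ (hphase t)]
  refine ⟨⟨?_, ?_⟩, fun F _ => ⟨hforw F, ?_⟩⟩
  · rintro ⟨F, _, h⟩
    obtain ⟨G, hGp, hG0, -, hG⟩ := hforw F h
    exact ⟨G, hGp, hG0, hG⟩
  · rintro ⟨G, _, hG0, hG⟩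
    exact ⟨mixtureLaw (-b₀) a₀ S G, inferInstance, hback G hG0 hG⟩
  · rintro ⟨G, _, hG0, hmix, hG⟩
    obtain rfl := (isNormalMixture_iff hS' _ _ hG0 F).1 hmix
    exact hback G hG0 hG
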